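/- Let $X$ be a real Banach space. For a set $I$ and a free (non-principal) ultrafilter $\mathcal U$ on $I$, let $X^{\mathcal U}$ be the ultrapower of $X$, i.e. the quotient of $\ell_\infty(I,X)$ (bounded families with the sup norm) by the closed subspace of families $(x_i)_{i\in I}$ with $\lim_{i,\mathcal U}\|x_i\|=0$; for a bounded set $K\subset X$ let $K^{\mathcal U}\subset X^{\mathcal U}$ be the set of classes of families $(x_i)_{i\in I}$ with $x_i\in K$ for all $i$. A weakly closed bounded set $K\subset X$ is called super weakly compact (SWC) if $K^{\mathcal U}$ is relatively weakly compact in $X^{\mathcal U}$ for every free ultrafilter $\mathcal U$ on every set $I$. Write $B_{X^*}$ for the closed unit ball of the dual $X^*$. **Theorem.** Let $C\subset X$ be closed, convex, bounded and symmetric ($-C=C$). The following are equivalent: (i) $C$ is not SWC; (ii) there exists $\theta>0$ such that for every finite-codimensional linear subspace $Y$ of $X$ (not assumed to be closed) and every $n\in\mathbb N$ there exist $x_1,\dots,x_n\in C\cap Y$ and $x_1^*,\dots,x_n^*\in B_{X^*}$ such that, for all $i,k\in\{1,\dots,n\}$, $x_i^*(x_k)=0$ if $i>k$ and $x_i^*(x_k)=\theta$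 if $i\le k$. -/

import Mathlib

open Filter Topology
open scoped ENNReal

universe u v

section Ultrapower

variable (X : Type u) [NormedAddCommGroup X] [NormedSpace ℝ X] {I : Type v} (𝓤 : Ultrafilter I)

/-- The subspace of `ℓ^∞(I, X)` of all bounded families `x` with `lim_{i, 𝓤} ‖x i‖ = 0`. -/
def ultraNull : Submodule ℝ (lp (fun _ : I => X) ∞) where
  carrier := {x | Tendsto (fun i => ‖x i‖) (𝓤 : Filter I) (𝓝 0)}
  zero_mem' := by simp
  add_mem' := by
    intro a b ha hb
    have ha' : Tendsto (fun i => ‖a i‖) (𝓤 : Filter I) (𝓝 0) := ha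
    have hb' : Tendsto (fun i => ‖b i‖) (𝓤 : Filter I) (𝓝 0) := hb
    have h : Tendsto (fun i => ‖a i‖ + ‖b i‖) (𝓤 : Filter I) (𝓝 0) := by
      simpa using ha'.add hb'
    exact squeeze_zero (fun i => norm_nonneg _) (fun i => norm_add_le _ _) h
  smul_mem' := by
    intro c a ha
    have ha' : Tendsto (fun i => ‖a i‖) (𝓤 : Filter I) (𝓝 0) := ha
    have h : Tendsto (fun i => ‖c‖ * ‖a i‖) (𝓤 : Filter I) (𝓝 0) := by
      simpa using ha'.const_mul ‖c‖
    exact squeeze_zero (fun i => norm_nonneg _) (fun i => norm_smul_le _ _) h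

/-- The null families form a closed subspace, so the quotient norm below is a norm. -/
instance ultraNull_isClosed : IsClosed (ultraNull X 𝓤 : Set (lp (fun _ : I => X) ∞)) := by
  rw [← isSeqClosed_iff_isClosed]
  intro s a hs ha
  change Tendsto (fun i => ‖a i‖) (𝓤 : Filter I) (𝓝 0)
  rw [Metric.tendsto_nhds]
  intro ε hε
  obtain ⟨n, hn⟩ := ((Metric.tendsto_nhds.1 ha) (ε / 2) (half_pos hε)).exists
  have h1 : Tendsto (fun i => ‖s n i‖) (𝓤 : Filter I) (𝓝 0) := hs n
  filter_upwards [(Metric.tendsto_nhds.1 h1) (ε / 2) (half_pos hε)] with i hi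
  have h2 : ‖(s n - a) i‖ ≤ ‖s n - a‖ := lp.norm_apply_le_norm ENNReal.top_ne_zero _ i
  have h3 : ‖a i‖ ≤ ‖s n i‖ + ‖(s n - a) i‖ := by
    have h4 : a i = s n i - (s n - a) i := by simp
    calc ‖a i‖ = ‖s n i - (s n - a) i‖ := by rw [← h4]
      _ ≤ _ := norm_sub_le _ _
  rw [dist_eq_norm] at hn
  simp only [dist_zero_right, norm_norm] at hi ⊢
  linarith

/-- The ultrapower `X^𝓤`: bounded families in `X` modulo those whose norms tend to zero along
`𝓤`, with the quotient norm of the sup norm. -/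
abbrev Ultrapower : Type (max u v) := lp (fun _ : I => X) ∞ ⧸ ultraNull X 𝓤

variable {X}

/-- `K^𝓤`: the classes in `X^𝓤` of the bounded families all of whose members lie in `K`. -/
def ultraSet (K : Set X) : Set (Ultrapower X 𝓤) :=
  {ξ | ∃ x : lp (fun _ : I => X) ∞, (∀ i, x i ∈ K) ∧ (ultraNull X 𝓤).mkQ x = ξ}

end Ultrapower

section SWC

variable {X : Type u} [NormedAddCommGroup X] [NormedSpace ℝ X]

/-- `A` is relatively weakly compact: its closure for the weak topology is weakly compact. -/
def IsRelWeaklyCompact (A : Set X) : Prop :=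
  IsCompact (closure (toWeakSpace ℝ X '' A))

/-- `K` is super weakly compact (SWC): it is weakly closed, and `K^𝓤` is relatively weakly compact
in `X^𝓤` for every free (that is, non-principal) ultrafilter `𝓤` on every index set `I`. -/
def IsSWC (K : Set X) : Prop :=
  IsClosed (toWeakSpace ℝ X '' K) ∧
    ∀ (I : Type v) (𝓤 : Ultrafilter I), (∀ i : I, 𝓤 ≠ pure i) →
      IsRelWeaklyCompact (ultraSet 𝓤 K)

end SWC

/-! By Hahn–Banach, a finite system is triangular iff its combinations satisfy `θ * |tail sum| ≤ ‖∑
k, a k • x k‖` for every tail (`isTriangular_iff`). This involves only norms of finite combinations,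
so it can be moved between `X` and its ultrapowers.

(i) ⇒ (ii): if some `C^𝓤` is not relatively weakly compact, a weak-star closure point of it in the
bidual is at positive distance from the space. Helly's lemma then gives long, almost triangular
systems in `C^𝓤`. A perturbation makes them triangular, and compactness of a finite-dimensional
sphere brings them down to `C`. Since `Y` need not be closed, no bounded projection is used to enter
it: the image of `C` in `X ⧸ Y` is covered by finitely many small translates, the pigeonhole
principle puts many terms in one translate, and corrected differences of these lie in `Y`.

(ii) ⇒ (i): with `Y = ⊤`, the finite systems glue to an infinite one in an ultrapower. At a weak
cluster point every functional equals `θ`, yet that point is a norm limit of finite combinations,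
each annihilated by all late functionals. -/

/-! ### Triangular systems and their stability. -/

section Triangular

variable {E : Type*} [NormedAddCommGroup E] [NormedSpace ℝ E]

/-- A linear functional dominated by the norm of `T` is induced by a functional of norm at most
one. -/
theorem exists_dual_comp_eq {V : Type*} [AddCommGroup V] [Module ℝ V] (T : V →ₗ[ℝ] E)
    (l : V →ₗ[ℝ] ℝ) (h : ∀ v, |l v| ≤ ‖T v‖) :
    ∃ f : StrongDual ℝ E, ‖f‖ ≤ 1 ∧ ∀ v, f (T v) = l v := by
  have hker : LinearMap.ker T ≤ LinearMap.ker l := fun v hv => by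
    have := h v
    rw [LinearMap.mem_ker.1 hv, norm_zero] at this
    exact abs_nonpos_iff.1 this
  let g : LinearMap.range T →ₗ[ℝ] ℝ :=
    ((LinearMap.ker T).liftQ l hker).comp T.quotKerEquivRange.symm.toLinearMap
  have hg : ∀ v, g ⟨T v, LinearMap.mem_range_self T v⟩ = l v := fun v => by
    have : T.quotKerEquivRange.symm ⟨T v, LinearMap.mem_range_self T v⟩ =
        (LinearMap.ker T).mkQ v := T.quotKerEquivRange_symm_apply_image v _
    simp [g, this]
  have hb : ∀ w, ‖g w‖ ≤ 1 * ‖w‖ := by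
    rintro ⟨_, v, rfl⟩
    rw [hg, one_mul]
    exact h v
  obtain ⟨f, hf, hn⟩ := exists_extension_norm_eq _ (g.mkContinuous 1 hb)
  refine ⟨f, hn ▸ g.mkContinuous_norm_le zero_le_one hb, fun v => ?_⟩
  rw [← hg v, hf ⟨T v, LinearMap.mem_range_self T v⟩]
  rfl

/-- `x` admits functionals `f i` in the dual unit ball with `f i (x k) = θ` for `i ≤ k` and
`f i (x k) = 0` for `k < i`. -/
def IsTriangular {ι : Type*} [LinearOrder ι] (θ : ℝ) (x : ι → E) : Prop :=
  ∀ i, ∃ f : StrongDual ℝ E, ‖f‖ ≤ 1 ∧ ∀ k, f (x k) = if i ≤ k then θ else 0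

theorem isTriangular_iff {ι : Type*} [LinearOrder ι] [Fintype ι] {θ : ℝ} (hθ : 0 ≤ θ)
    {x : ι → E} : IsTriangular θ x ↔
      ∀ (a : ι → ℝ) (i : ι), θ * |∑ k, if i ≤ k then a k else 0| ≤ ‖∑ k, a k • x k‖ := by
  constructor
  · intro h a i
    obtain ⟨f, hf, hfx⟩ := h i
    have h1 : f (∑ k, a k • x k) = θ * ∑ k, if i ≤ k then a k else 0 := by
      rw [map_sum, Finset.mul_sum]
      refine Finset.sum_congr rfl fun k _ => ?_
      rw [map_smul, hfx, smul_eq_mul]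
      split_ifs <;> ring
    calc θ * |∑ k, if i ≤ k then a k else 0| = ‖f (∑ k, a k • x k)‖ := by
          rw [h1, Real.norm_eq_abs, abs_mul, abs_of_nonneg hθ]
      _ ≤ ‖f‖ * ‖∑ k, a k • x k‖ := f.le_opNorm _
      _ ≤ 1 * ‖∑ k, a k • x k‖ := by gcongr
      _ = _ := one_mul _
  · intro h i
    have key (a : ι → ℝ) : Fintype.linearCombination ℝ (fun k => if i ≤ k then θ else 0) a =
        θ * ∑ k, if i ≤ k then a k else 0 := by
      rw [Fintype.linearCombination_apply, Finset.mul_sum]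
      refine Finset.sum_congr rfl fun k _ => ?_
      rw [smul_eq_mul]
      split_ifs <;> ring
    obtain ⟨f, hf, hfx⟩ := exists_dual_comp_eq (Fintype.linearCombination ℝ x)
      (Fintype.linearCombination ℝ fun k => if i ≤ k then θ else 0) fun a => by
        rw [key, abs_mul, abs_of_nonneg hθ, Fintype.linearCombination_apply]
        exact h a i
    refine ⟨f, hf, fun k => ?_⟩
    have := hfx (Pi.single k 1)
    simpa [Fintype.linearCombination_apply_single] using this

/-- A coefficient is the difference of two consecutive tail sums; the last one is itself a tail sum.
-/
theorem abs_apply_le_of_abs_tail_le {n : ℕ} {a : Fin n → ℝ} {M : ℝ}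
    (h : ∀ i, |∑ k, if i ≤ k then a k else 0| ≤ M) (k : Fin n) : |a k| ≤ 2 * M := by
  have hM : 0 ≤ M := (abs_nonneg _).trans (h k)
  have hk := h k
  by_cases hlt : k.val + 1 < n
  · have hk' := h ⟨k.val + 1, hlt⟩
    have : a k = (∑ j, if k ≤ j then a j else 0) -
        ∑ j, if (⟨k.val + 1, hlt⟩ : Fin n) ≤ j then a j else 0 := by
      rw [← Finset.sum_sub_distrib, Finset.sum_eq_single k]
      · simp [Fin.le_def]
      · intro j _ hj
        have : j.val ≠ k.val := fun h => hj (Fin.ext h)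
        simp only [Fin.le_def]
        split_ifs <;> first | omega | simp
      · simp
    rw [this]
    exact (abs_sub _ _).trans (by linarith)
  · have : (∑ j, if k ≤ j then a j else 0) = a k := by
      rw [Finset.sum_eq_single k]
      · simp
      · intro j _ hj
        have : j.val ≠ k.val := fun h => hj (Fin.ext h)
        have := j.isLt
        simp only [Fin.le_def]
        split_ifs <;> first | omega | simp
      · simp
    rw [this] at hk
    linarith

/-- A small perturbation of a triangular system is triangular. -/
theorem IsTriangular.of_approx {n : ℕ} {θ δ : ℝ} (hδ : 4 * n * δ ≤ θ) (hθ : 0 ≤ θ)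
    {x : Fin n → E} {f : Fin n → StrongDual ℝ E} (hf : ∀ i, ‖f i‖ ≤ 1)
    (h : ∀ i k, |f i (x k) - if i ≤ k then θ else 0| ≤ δ) : IsTriangular (θ / 2) x := by
  rw [isTriangular_iff (by positivity)]
  intro a i
  have : Nonempty (Fin n) := ⟨i⟩
  -- At the largest tail `M`, all coefficients are at most `2 * M`, so the total error is at most `θ
  -- * M / 2` and is absorbed.
  obtain ⟨m, hm⟩ := Finite.exists_max fun i => |∑ k, if i ≤ k then a k else 0|
  set M := |∑ k, if m ≤ k then a k else 0| with hM
  have ha := abs_apply_le_of_abs_tail_le hm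
  have h1 : f m (∑ k, a k • x k) - θ * (∑ k, if m ≤ k then a k else 0) =
      ∑ k, a k * (f m (x k) - if m ≤ k then θ else 0) := by
    rw [map_sum, Finset.mul_sum, ← Finset.sum_sub_distrib]
    refine Finset.sum_congr rfl fun k _ => ?_
    rw [map_smul, smul_eq_mul]
    split_ifs <;> ring
  have h2 : |f m (∑ k, a k • x k) - θ * (∑ k, if m ≤ k then a k else 0)| ≤ n * (2 * M * δ) := by
    rw [h1]
    refine (Finset.abs_sum_le_sum_abs _ _).trans ?_
    calc _ ≤ ∑ _k : Fin n, 2 * M * δ := Finset.sum_le_sum fun k _ => by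
          rw [abs_mul]
          exact mul_le_mul (ha k) (h m k) (abs_nonneg _) (by positivity)
      _ = _ := by simp
  have h3 : |f m (∑ k, a k • x k)| ≤ ‖∑ k, a k • x k‖ := by
    refine ((f m).le_opNorm _).trans ?_
    exact mul_le_of_le_one_left (norm_nonneg _) (hf m)
  have h4 : θ * M ≤ |f m (∑ k, a k • x k)| + n * (2 * M * δ) := by
    have := abs_sub_abs_le_abs_sub (θ * (∑ k, if m ≤ k then a k else 0)) (f m (∑ k, a k • x k))
    rw [abs_sub_comm, abs_mul, abs_of_nonneg hθ, ← hM] at this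
    linarith
  have h5 : n * (2 * M * δ) ≤ θ * M / 2 := by
    have := mul_le_mul_of_nonneg_right hδ (abs_nonneg _ : 0 ≤ M)
    linarith
  have h6 := mul_le_mul_of_nonneg_left (hm i) hθ
  linarith

end Triangular

/-! ### Norms in the ultrapower and descent to coordinates. -/

section UltrapowerNorm

variable {X : Type u} [NormedAddCommGroup X] [NormedSpace ℝ X] {I : Type v} {𝓤 : Ultrafilter I}

theorem le_norm_mkQ_of_eventually_le {x : lp (fun _ : I => X) ∞} {c : ℝ}
    (h : ∀ᶠ i in (𝓤 : Filter I), c ≤ ‖x i‖) : c ≤ ‖(ultraNull X 𝓤).mkQ x‖ := by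
  refine le_of_forall_pos_le_add fun ε hε => ?_
  obtain ⟨y, hy, hlt⟩ := Submodule.Quotient.norm_mk_lt ((ultraNull X 𝓤).mkQ x) (half_pos hε)
  have hxy : y - x ∈ ultraNull X 𝓤 := (Submodule.Quotient.eq _).1 hy
  have hnull : Tendsto (fun i => ‖(y - x) i‖) (𝓤 : Filter I) (𝓝 0) := hxy
  obtain ⟨i, hi, hi'⟩ := (h.and (hnull.eventually_lt_const (half_pos hε))).exists
  have h1 : ‖x i‖ ≤ ‖y i‖ + ‖(y - x) i‖ := by
    have : x i = y i - (y - x) i := by simp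
    calc ‖x i‖ = ‖y i - (y - x) i‖ := by rw [← this]
      _ ≤ _ := norm_sub_le _ _
  have h2 : ‖y i‖ ≤ ‖y‖ := lp.norm_apply_le_norm ENNReal.top_ne_zero y i
  linarith

/-- Replacing the members of norm above `c` by zero does not change the class. -/
theorem norm_mkQ_le_of_eventually_le {x : lp (fun _ : I => X) ∞} {c : ℝ} (hc : 0 ≤ c)
    (h : ∀ᶠ i in (𝓤 : Filter I), ‖x i‖ ≤ c) : ‖(ultraNull X 𝓤).mkQ x‖ ≤ c := by
  classical
  let y : lp (fun _ : I => X) ∞ := ⟨fun i => if ‖x i‖ ≤ c then x i else 0, memℓp_infty ⟨c, by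
    rintro _ ⟨i, rfl⟩
    dsimp only
    split_ifs with hi
    · exact hi
    · simpa using hc⟩⟩
  have hy : ‖y‖ ≤ c := lp.norm_le_of_forall_le hc fun i => by
    change ‖if ‖x i‖ ≤ c then x i else 0‖ ≤ c
    split_ifs with hi
    · exact hi
    · simpa using hc
  have hxy : (ultraNull X 𝓤).mkQ x = (ultraNull X 𝓤).mkQ y := by
    refine (Submodule.Quotient.eq _).2 ?_
    change Tendsto (fun i => ‖(x - y) i‖) (𝓤 : Filter I) (𝓝 0)
    refine (tendsto_congr' ?_).2 tendsto_const_nhds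
    filter_upwards [h] with i hi
    have : y i = x i := if_pos hi
    simp [this]
  rw [hxy]
  exact (Submodule.Quotient.norm_mk_le _ y).trans hy

theorem isBounded_ultraSet {K : Set X} (hK : Bornology.IsBounded K) :
    Bornology.IsBounded (ultraSet 𝓤 K) := by
  obtain ⟨M, hM⟩ := hK.exists_norm_le
  refine (isBounded_iff_forall_norm_le).2 ⟨max M 0, ?_⟩
  rintro _ ⟨x, hx, rfl⟩
  exact norm_mkQ_le_of_eventually_le (le_max_right _ _)
    (Eventually.of_forall fun i => (hM _ (hx i)).trans (le_max_left _ _))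

/-- Triangularity of finitely many elements of an ultrapower is inherited, up to a factor, by the
members of representing families. -/
theorem exists_isTriangular_of_mkQ {n : ℕ} {θ : ℝ} (hθ : 0 < θ)
    {x : Fin n → lp (fun _ : I => X) ∞}
    (h : IsTriangular θ fun k => (ultraNull X 𝓤).mkQ (x k)) :
    ∃ i, IsTriangular (θ / 2) fun k => x k i := by
  by_contra! hcon
  have hθ2 : 0 ≤ θ / 2 := by positivity
  rw [isTriangular_iff hθ.le] at h
  -- For the sup norm, triangularity reads `θ * ‖R a‖ ≤ ‖∑ k, a k • x k‖`. As `R` is homogeneous, a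
  -- failure at each coordinate can be normalised to the unit sphere.
  let R : (Fin n → ℝ) → Fin n → ℝ := fun a j => ∑ k, if j ≤ k then a k else 0
  have hRc : Continuous R := by
    refine continuous_pi fun j => continuous_finsetSum _ fun k _ => ?_
    split_ifs <;> fun_prop
  have hR : ∀ a, R a = 0 → a = 0 := fun a ha => by
    ext k
    have := abs_apply_le_of_abs_tail_le (a := a) (M := 0) (fun j => by
      have := congrFun ha j
      simp only [R, Pi.zero_apply] at this
      simp [this]) k
    simpa using this
  have hhom : ∀ (c : ℝ) a, R (c • a) = c • R a := fun c a => by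
    ext j
    simp only [R, Pi.smul_apply, smul_eq_mul, Finset.mul_sum]
    refine Finset.sum_congr rfl fun k _ => ?_
    split_ifs <;> simp
  have hsphere : ∀ i, ∃ a : Fin n → ℝ, ‖a‖ = 1 ∧ ‖∑ k, a k • x k i‖ ≤ θ / 2 * ‖R a‖ := by
    intro i
    have := hcon i
    rw [isTriangular_iff hθ2] at this
    push Not at this
    obtain ⟨a, j, haj⟩ := this
    have ha : a ≠ 0 := by
      rintro rfl
      simp at haj
    have ha' : ‖a‖ ≠ 0 := norm_ne_zero_iff.2 ha
    have hle : ‖∑ k, a k • x k i‖ ≤ θ / 2 * ‖R a‖ := haj.le.trans (by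
      gcongr
      exact norm_le_pi_norm (R a) j)
    refine ⟨‖a‖⁻¹ • a, by rw [norm_smul, norm_inv, norm_norm, inv_mul_cancel₀ ha'], ?_⟩
    have : ∑ k, (‖a‖⁻¹ • a) k • x k i = ‖a‖⁻¹ • ∑ k, a k • x k i := by
      simp [Finset.smul_sum, mul_smul]
    rw [this, hhom, norm_smul, norm_smul, mul_left_comm]
    gcongr
  choose a ha hle using hsphere
  -- The limit `b` of the failing coefficients satisfies `θ * ‖R b‖ ≤ θ / 2 * ‖R b‖`, so `R b = 0`
  -- and `b = 0`, although `‖b‖ = 1`.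
  obtain ⟨b, hb, hlim⟩ := (isCompact_sphere (0 : Fin n → ℝ) 1).ultrafilter_le_nhds'
    (𝓤.map a) (Ultrafilter.mem_map.2 (Filter.univ_mem' fun i => by simp [ha i]))
  have hab : Tendsto a (𝓤 : Filter I) (𝓝 b) := hlim
  have hb1 : ‖b‖ = 1 := by simpa using hb
  have hdiff : Tendsto (fun i => θ / 2 * ‖R (a i)‖ + ∑ k, ‖b k - a i k‖ * ‖x k‖) (𝓤 : Filter I)
      (𝓝 (θ / 2 * ‖R b‖ + ∑ k, ‖b k - b k‖ * ‖x k‖)) := by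
    refine Tendsto.add (((hRc.tendsto b).comp hab).norm.const_mul _) ?_
    exact tendsto_finsetSum _ fun k _ => Tendsto.mul_const _
      (tendsto_const_nhds.sub (((continuous_apply k).tendsto b).comp hab)).norm
  simp only [sub_self, norm_zero, zero_mul, Finset.sum_const_zero, add_zero] at hdiff
  have hbound : ∀ i, ‖(∑ k, b k • x k : lp (fun _ : I => X) ∞) i‖ ≤
      θ / 2 * ‖R (a i)‖ + ∑ k, ‖b k - a i k‖ * ‖x k‖ := by
    intro i
    have : (∑ k, b k • x k : lp (fun _ : I => X) ∞) i =
        ∑ k, a i k • x k i + ∑ k, (b k - a i k) • x k i := by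
      rw [← Finset.sum_add_distrib, lp.coeFn_sum, Finset.sum_apply]
      refine Finset.sum_congr rfl fun k _ => ?_
      rw [← add_smul, add_sub_cancel]
      rfl
    rw [this]
    refine (norm_add_le _ _).trans (add_le_add (hle i) ((norm_sum_le _ _).trans ?_))
    refine Finset.sum_le_sum fun k _ => ?_
    rw [norm_smul]
    gcongr
    exact lp.norm_apply_le_norm ENNReal.top_ne_zero (x k) i
  have hZ : ‖∑ k, b k • (ultraNull X 𝓤).mkQ (x k)‖ ≤ θ / 2 * ‖R b‖ := by
    refine le_of_forall_pos_le_add fun ε hε => ?_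
    have : ∑ k, b k • (ultraNull X 𝓤).mkQ (x k) = (ultraNull X 𝓤).mkQ (∑ k, b k • x k) := by
      simp only [map_sum, map_smul]
    rw [this]
    refine norm_mkQ_le_of_eventually_le (by positivity) ?_
    filter_upwards [hdiff.eventually_lt_const (lt_add_of_pos_right _ hε)] with i hi
    exact (hbound i).trans hi.le
  have hRb : θ * ‖R b‖ ≤ θ / 2 * ‖R b‖ := by
    rw [← le_div_iff₀' hθ]
    refine (pi_norm_le_iff_of_nonneg (by positivity)).2 fun j => ?_
    rw [le_div_iff₀' hθ]
    exact (h b j).trans hZ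
  have hzero : ‖R b‖ = 0 := by
    have := norm_nonneg (R b)
    nlinarith
  rw [hR b (norm_eq_zero.1 hzero), norm_zero] at hb1
  exact zero_ne_one hb1

end UltrapowerNorm

/-! ### Triangular systems from a bidual point outside the space. -/

section Bidual

open NormedSpace

variable {Z : Type*} [NormedAddCommGroup Z] [NormedSpace ℝ Z]

theorem StrongDual.norm_smul_eq (b : ℝ) (f : StrongDual ℝ Z) : ‖b • f‖ = |b| * ‖f‖ :=
  norm_smul b f

theorem StrongDual.dist_eq_norm_sub (f g : StrongDual ℝ Z) : dist f g = ‖f - g‖ :=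
  dist_eq_norm f g

/-- A form of Helly's lemma: if `ζ` is at distance at least `θ` from `Z` in the bidual, then there
are functionals in the unit ball that are almost zero on a given finite set and on which `ζ` is
almost `θ`. -/
theorem exists_functional_of_le_norm_sub_inclusion (ζ : StrongDual ℝ (StrongDual ℝ Z)) {θ ε : ℝ}
    (hθ : 0 ≤ θ) (hd : ∀ z, θ ≤ ‖ζ - inclusionInDoubleDual ℝ Z z‖) (hε : 0 < ε) (s : Finset Z) :
    ∃ f : StrongDual ℝ Z, ‖f‖ ≤ 1 ∧ |ζ f - θ| ≤ ε ∧ ∀ z ∈ s, |f z| ≤ ε := by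
  classical
  let S : StrongDual ℝ Z →L[ℝ] ℝ × (s → ℝ) :=
    ζ.prod (ContinuousLinearMap.pi fun z : s => inclusionInDoubleDual ℝ Z z)
  by_cases hmem : ((θ, 0) : ℝ × (s → ℝ)) ∈ closure (S '' Metric.closedBall 0 1)
  · obtain ⟨_, ⟨f, hf, rfl⟩, hdist⟩ := Metric.mem_closure_iff.1 hmem ε hε
    have hdist' : dist (S f) (θ, 0) ≤ ε := by rw [dist_comm]; exact hdist.le
    rw [Prod.dist_eq, max_le_iff] at hdist'
    refine ⟨f, by simpa using hf, by simpa [S, Real.dist_eq] using hdist'.1, fun z hz => ?_⟩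
    simpa [S, Real.dist_eq] using (dist_le_pi_dist _ _ (⟨z, hz⟩ : s)).trans hdist'.2
  · exfalso
    -- A separating functional composed with `S` is `b • ζ + w` with `w` in `Z`. Its norm is at most
    -- `u`, but the distance hypothesis makes it at least `|b| * θ ≥ φ (θ, 0) > u`.
    obtain ⟨φ, u, hu, hlt⟩ := geometric_hahn_banach_closed_point
      (((convex_closedBall (0 : StrongDual ℝ Z) 1).linear_image S.toLinearMap).closure)
      isClosed_closure hmem
    have hball : ∀ f : StrongDual ℝ Z, ‖f‖ ≤ 1 → φ (S f) < u := fun f hf =>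
      hu _ (subset_closure ⟨f, by simpa using hf, rfl⟩)
    have hu0 : 0 < u := by simpa using hball 0 (by simp)
    set b := φ (1, 0) with hb
    let w : Z := ∑ z : s, φ (0, Pi.single z 1) • (z : Z)
    have hrep : ∀ f, φ (S f) = b * ζ f + f w := by
      intro f
      have h1 : S f = ζ f • ((1, 0) : ℝ × (s → ℝ)) +
          ∑ z : s, f z • ((0, Pi.single z 1) : ℝ × (s → ℝ)) := by
        refine Prod.ext ?_ ?_
        · simp [S, Prod.fst_sum]
        · ext z
          simp [S, Prod.snd_sum, Finset.sum_apply, Pi.single_apply]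
      rw [h1, map_add, map_smul, map_sum, map_sum, smul_eq_mul, mul_comm]
      congr 1
      refine Finset.sum_congr rfl fun z _ => ?_
      rw [map_smul, map_smul, smul_eq_mul, smul_eq_mul, mul_comm]
    have hnorm : ‖b • ζ + inclusionInDoubleDual ℝ Z w‖ ≤ u := by
      refine ContinuousLinearMap.opNorm_le_of_unit_norm hu0.le fun f hf => ?_
      have h1 := hball f hf.le
      have h2 := hball (-f) (by rw [norm_neg, hf])
      rw [map_neg, map_neg] at h2
      have h3 : (b • ζ + inclusionInDoubleDual ℝ Z w) f = φ (S f) := by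
        rw [hrep]
        rfl
      rw [h3, Real.norm_eq_abs, abs_le]
      constructor <;> linarith
    have hge : |b| * θ ≤ ‖b • ζ + inclusionInDoubleDual ℝ Z w‖ := by
      rcases eq_or_ne b 0 with h0 | h0
      · rw [h0, abs_zero, zero_mul]
        exact ContinuousLinearMap.opNorm_nonneg _
      · have h1 : b • ζ + inclusionInDoubleDual ℝ Z w =
            b • (ζ - inclusionInDoubleDual ℝ Z (-(b⁻¹ • w))) := by
          rw [map_neg, map_smul, sub_neg_eq_add, smul_add, smul_smul, mul_inv_cancel₀ h0, one_smul]
        rw [h1, StrongDual.norm_smul_eq]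
        gcongr
        exact hd _
    have h1 : φ (θ, 0) = b * θ := by
      have : ((θ, 0) : ℝ × (s → ℝ)) = θ • ((1, 0) : ℝ × (s → ℝ)) := by simp
      rw [this, map_smul, smul_eq_mul, mul_comm]
    have h2 : b * θ ≤ |b| * θ := by
      gcongr
      exact le_abs_self b
    rw [h1] at hlt
    linarith

/-- A bounded set that is not relatively weakly compact contains arbitrarily long triangular
systems, for a common constant. -/
theorem exists_isTriangular_of_not_isRelWeaklyCompact [CompleteSpace Z] {D : Set Z}
    (hD : Bornology.IsBounded D) (h : ¬ IsRelWeaklyCompact D) :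
    ∃ θ : ℝ, 0 < θ ∧ ∀ n : ℕ, ∃ x : Fin n → Z, (∀ k, x k ∈ D) ∧ IsTriangular θ x := by
  -- Bounded sets are relatively weak-star compact in the bidual, so weak compactness can fail only
  -- through a closure point outside `Z`.
  have hrange : ¬ closure (inclusionInDoubleDualWeak ℝ Z '' (toWeakSpace ℝ Z '' D)) ⊆
      Set.range (inclusionInDoubleDualWeak ℝ Z) := fun hr =>
    h (isCompact_closure_of_isBounded ℝ Z _
      (by rwa [Set.preimage_image_eq _ (toWeakSpace ℝ Z).injective]) hr)
  obtain ⟨ζ, hζ, hζr⟩ := Set.not_subset.1 hrange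
  let ζ' : StrongDual ℝ (StrongDual ℝ Z) := WeakDual.toStrongDual ζ
  have happrox : ∀ (t : Finset (StrongDual ℝ Z)) (ε : ℝ), 0 < ε →
      ∃ x ∈ D, ∀ f ∈ t, |f x - ζ' f| ≤ ε := by
    intro t ε hε
    have hnhds : {η : WeakDual ℝ (StrongDual ℝ Z) | ∀ f ∈ t, |η f - ζ f| < ε} ∈ 𝓝 ζ := by
      have : ∀ f ∈ t, ∀ᶠ η : WeakDual ℝ (StrongDual ℝ Z) in 𝓝 ζ, |η f - ζ f| < ε := fun f _ => by
        have := ((WeakDual.eval_continuous (𝕜 := ℝ) f).tendsto ζ).eventually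
          (Metric.ball_mem_nhds _ hε)
        exact this
      exact (Filter.eventually_all_finset t).2 this
    obtain ⟨_, hη, _, ⟨x, hx, rfl⟩, rfl⟩ := mem_closure_iff_nhds.1 hζ _ hnhds
    exact ⟨x, hx, fun f hf => (hη f hf).le⟩
  have hclosed : IsClosed (Set.range (inclusionInDoubleDual ℝ Z)) :=
    (inclusionInDoubleDualLi (E := Z) ℝ).isometry.isUniformInducing.isComplete_range.isClosed
  have hnot : ζ' ∉ Set.range (inclusionInDoubleDual ℝ Z) := by
    rintro ⟨z, hz⟩
    exact hζr ⟨toWeakSpace ℝ Z z, hz⟩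
  set θ := Metric.infDist ζ' (Set.range (inclusionInDoubleDual ℝ Z)) with hθdef
  have hθ : 0 < θ := (hclosed.notMem_iff_infDist_pos (Set.range_nonempty _)).1 hnot
  have hdist : ∀ z, θ ≤ ‖ζ' - inclusionInDoubleDual ℝ Z z‖ := fun z => by
    rw [← StrongDual.dist_eq_norm_sub]
    exact Metric.infDist_le_dist_of_mem ⟨z, rfl⟩
  refine ⟨θ / 2, half_pos hθ, fun n => ?_⟩
  obtain ⟨ε, hε, hεn⟩ : ∃ ε : ℝ, 0 < ε ∧ 4 * n * (2 * ε) ≤ θ := by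
    refine ⟨θ / (8 * (n + 1)), by positivity, ?_⟩
    have : 4 * (n : ℝ) * (2 * (θ / (8 * (n + 1)))) = θ * (n / (n + 1)) := by
      field_simp
      ring
    rw [this]
    exact mul_le_of_le_one_right hθ.le ((div_le_one (by positivity)).2 (by linarith))
  classical
  -- Each new functional is almost zero on the earlier points; the new point then imitates `ζ'` on
  -- this functional and all earlier ones.
  obtain ⟨p, hp, hpp⟩ := exists_seq_of_forall_finset_exists
    (fun p : StrongDual ℝ Z × Z => ‖p.1‖ ≤ 1 ∧ p.2 ∈ D ∧ |ζ' p.1 - θ| ≤ ε ∧ |p.1 p.2 - ζ' p.1| ≤ ε)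
    (fun p q => |q.1 p.2| ≤ ε ∧ |p.1 q.2 - ζ' p.1| ≤ ε) (by
      intro s _
      obtain ⟨f, hf, hζf, hfz⟩ := exists_functional_of_le_norm_sub_inclusion ζ' hθ.le hdist hε
        (s.image Prod.snd)
      obtain ⟨x, hx, hxf⟩ := happrox (insert f (s.image Prod.fst)) ε hε
      exact ⟨(f, x), ⟨hf, hx, hζf, hxf f (Finset.mem_insert_self _ _)⟩, fun q hq =>
        ⟨hfz _ (Finset.mem_image_of_mem _ hq),
          hxf _ (Finset.mem_insert_of_mem (Finset.mem_image_of_mem _ hq))⟩⟩)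
  refine ⟨fun k => (p k).2, fun k => (hp k).2.1,
    IsTriangular.of_approx hεn hθ.le (f := fun k => (p k).1) (fun k => (hp k).1) fun i k => ?_⟩
  have hclose : ∀ y, |(p i).1 y - ζ' (p i).1| ≤ ε → |(p i).1 y - θ| ≤ 2 * ε := fun y hy => by
    have := abs_sub_le ((p i).1 y) (ζ' (p i).1) θ
    have := (hp i).2.2.1
    linarith
  rcases lt_trichotomy i k with hik | rfl | hik
  · rw [if_pos hik.le]
    exact hclose _ (hpp i k hik).2
  · rw [if_pos le_rfl]
    exact hclose _ (hp i).2.2.2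
  · rw [if_neg hik.not_ge, sub_zero]
    exact (hpp k i hik).1.trans (by linarith)

end Bidual

/-! ### Passing to subspaces of finite codimension. -/

section FiniteCodimension

/-- The unit ball of a seminorm on a finite-dimensional space is totally bounded. -/
theorem Seminorm.exists_finset_forall_sub_lt {V : Type*} [AddCommGroup V] [Module ℝ V]
    [FiniteDimensional ℝ V] (p : Seminorm ℝ V) {ε : ℝ} (hε : 0 < ε) :
    ∃ t : Finset V, ∀ v, p v ≤ 1 → ∃ u ∈ t, p (v - u) < ε := by
  let : SeminormedAddCommGroup V := p.toAddGroupSeminorm.toSeminormedAddCommGroup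
  let : NormedSpace ℝ V := ⟨fun a b => (map_smul_eq_mul p a b).le⟩
  have hfin : FiniteDimensional ℝ (SeparationQuotient V) :=
    Module.Finite.of_surjective (SeparationQuotient.mkCLM ℝ V).toLinearMap
      SeparationQuotient.surjective_mk
  have : ProperSpace (SeparationQuotient V) := FiniteDimensional.proper ℝ _
  have hb : TotallyBounded (SeparationQuotient.mk ⁻¹' Metric.closedBall (0 : SeparationQuotient V) 1) :=
    totallyBounded_preimage SeparationQuotient.isUniformInducing_mk
      (isCompact_closedBall _ _).totallyBounded
  obtain ⟨t, ht, hcov⟩ := Metric.totallyBounded_iff.1 hb ε hε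
  refine ⟨ht.toFinset, fun v hv => ?_⟩
  have hv' : v ∈ SeparationQuotient.mk ⁻¹' Metric.closedBall (0 : SeparationQuotient V) 1 := by
    rw [Set.mem_preimage, mem_closedBall_zero_iff, SeparationQuotient.norm_mk]
    exact hv
  obtain ⟨u, hu, huv⟩ := Set.mem_iUnion₂.1 (hcov hv')
  refine ⟨u, ht.mem_toFinset.2 hu, ?_⟩
  rw [Metric.mem_ball, dist_eq_norm] at huv
  exact huv

/-- A convex symmetric subset of a finite-dimensional space is covered by finitely many translates
of its multiples. -/
theorem Convex.exists_finset_forall_eq_add_smul {V : Type*} [AddCommGroup V] [Module ℝ V]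
    [FiniteDimensional ℝ V] {S : Set V} (hS : Convex ℝ S) (hneg : ∀ v ∈ S, -v ∈ S)
    (hne : S.Nonempty) {ε : ℝ} (hε : 0 < ε) :
    ∃ t : Finset V, ∀ v ∈ S, ∃ u ∈ t, ∃ s ∈ S, v = u + ε • s := by
  classical
  have h0 : (0 : V) ∈ S := by
    obtain ⟨v, hv⟩ := hne
    have := hS hv (hneg v hv) (by norm_num : (0 : ℝ) ≤ 1 / 2) (by norm_num : (0 : ℝ) ≤ 1 / 2)
      (by norm_num)
    simpa using this
  have hscale : ∀ v ∈ S, ∀ c : ℝ, |c| ≤ 1 → c • v ∈ S := by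
    intro v hv c hc
    rcases le_total 0 c with h | h
    · exact hS.smul_mem_of_zero_mem h0 hv ⟨h, (abs_of_nonneg h) ▸ hc⟩
    · have := hS.smul_mem_of_zero_mem h0 (hneg v hv) (t := -c)
        ⟨by linarith, (abs_of_nonpos h) ▸ hc⟩
      simpa using this
  -- `S` is absorbent only in its span, where its gauge is a seminorm.
  let W := Submodule.span ℝ S
  let T : Set W := {w | (w : V) ∈ S}
  have hTconv : Convex ℝ T := hS.linear_preimage W.subtype
  have hTbal : Balanced ℝ T := by
    rintro c hc _ ⟨w, hw, rfl⟩
    exact hscale _ hw c hc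
  have hspan : ∀ w ∈ W, ∃ r : ℝ, 0 < r ∧ r⁻¹ • w ∈ S := by
    intro w hw
    induction hw using Submodule.span_induction with
    | mem v hv => exact ⟨1, one_pos, by simpa using hv⟩
    | zero => exact ⟨1, one_pos, by simpa using h0⟩
    | add v w _ _ hv hw =>
      obtain ⟨r, hr, hv⟩ := hv
      obtain ⟨q, hq, hw⟩ := hw
      refine ⟨r + q, by positivity, ?_⟩
      have := hS hv hw (a := r / (r + q)) (b := q / (r + q)) (by positivity) (by positivity)
        (by field_simp)
      rw [smul_smul, smul_smul] at this
      convert this using 1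
      rw [smul_add]
      congr 2 <;> field_simp
    | smul c v _ hv =>
      obtain ⟨r, hr, hv⟩ := hv
      refine ⟨r * (|c| + 1), by positivity, ?_⟩
      have := hscale _ hv (c / (|c| + 1)) (by
        rw [abs_div, abs_of_pos (by positivity : (0 : ℝ) < |c| + 1)]
        exact (div_le_one (by positivity)).2 (by linarith))
      rw [smul_smul] at this ⊢
      convert this using 2
      field_simp
  have hTabs : Absorbent ℝ T := by
    intro w
    obtain ⟨r, hr, hrw⟩ := hspan w w.2
    refine Absorbs.of_norm ⟨r, fun c hc => Set.singleton_subset_iff.2 ?_⟩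
    have hc0 : c ≠ 0 := by
      rintro rfl
      simp at hc
      linarith
    rw [Set.mem_smul_set_iff_inv_smul_mem₀ hc0]
    change ((c⁻¹ • w : W) : V) ∈ S
    have := hscale _ hrw (c⁻¹ * r) (by
      rw [abs_mul, abs_inv, abs_of_pos hr, inv_mul_le_iff₀ (abs_pos.2 hc0), mul_one]
      exact hc)
    rw [smul_smul, mul_assoc, mul_inv_cancel₀ hr.ne', mul_one] at this
    exact this
  obtain ⟨t, ht⟩ := (gaugeSeminorm hTbal hTconv hTabs).exists_finset_forall_sub_lt hε
  refine ⟨t.image (↑), fun v hv => ?_⟩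
  obtain ⟨u, hu, huv⟩ := ht ⟨v, Submodule.subset_span hv⟩ (gauge_le_one_of_mem hv)
  obtain ⟨b, hb, hbε, s, hs, hsv⟩ := exists_lt_of_gauge_lt hTabs huv
  refine ⟨u, Finset.mem_image_of_mem _ hu, (b / ε) • (s : V), hscale _ hs _ ?_, ?_⟩
  · rw [abs_of_pos (by positivity)]
    exact (div_le_one hε).2 hbε.le
  · have h1 := congrArg (Subtype.val) hsv
    simp only [Submodule.coe_smul, AddSubgroupClass.coe_sub] at h1
    rw [smul_smul, mul_div_cancel₀ _ hε.ne', h1, add_sub_cancel]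

variable {X : Type*} [NormedAddCommGroup X] [NormedSpace ℝ X]

/-- If a bounded convex symmetric set contains arbitrarily long triangular systems, then so does its
intersection with any subspace of finite codimension, with a constant that does not depend on the
subspace. -/
theorem exists_isTriangular_mem_of_finiteDimensional_quotient {C : Set X} (hconvex : Convex ℝ C)
    (hbounded : Bornology.IsBounded C) (hsymm : ∀ x ∈ C, -x ∈ C) {θ : ℝ} (hθ : 0 < θ)
    (h : ∀ n : ℕ, ∃ x : Fin n → X, (∀ k, x k ∈ C) ∧ IsTriangular θ x)
    (Y : Submodule ℝ X) [FiniteDimensional ℝ (X ⧸ Y)] (n : ℕ) :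
    ∃ x : Fin n → X, (∀ k, x k ∈ C ∧ x k ∈ Y) ∧ IsTriangular (θ / 8) x := by
  classical
  obtain ⟨M, hM0, hM⟩ := hbounded.exists_pos_norm_le
  obtain ⟨ε, hε, hε1, hεn⟩ : ∃ ε : ℝ, 0 < ε ∧ ε ≤ 1 ∧ 4 * n * (ε * M) ≤ θ / 4 := by
    refine ⟨min 1 (θ / (16 * (n + 1) * M)), by positivity, min_le_left _ _, ?_⟩
    calc 4 * n * (min 1 (θ / (16 * (n + 1) * M)) * M)
        ≤ 4 * n * (θ / (16 * (n + 1) * M) * M) := by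
          gcongr
          exact min_le_right _ _
      _ = θ / 4 * (n / (n + 1)) := by field_simp; ring
      _ ≤ θ / 4 := mul_le_of_le_one_right (by positivity)
          ((div_le_one (by positivity)).2 (by linarith))
  have hne : C.Nonempty := by
    obtain ⟨x, hx, -⟩ := h 1
    exact ⟨x 0, hx 0⟩
  have hlin : Convex ℝ (Y.mkQ '' C) := hconvex.linear_image Y.mkQ
  obtain ⟨t, ht⟩ := hlin.exists_finset_forall_eq_add_smul
    (by rintro _ ⟨x, hx, rfl⟩; exact ⟨-x, hsymm x hx, map_neg _ _⟩) (hne.image _) hε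
  have ht' : ∀ x ∈ C, ∃ u ∈ t, ∃ s ∈ C, Y.mkQ x = u + ε • Y.mkQ s := fun x hx => by
    obtain ⟨u, hu, _, ⟨s, hs, rfl⟩, he⟩ := ht _ ⟨x, hx, rfl⟩
    exact ⟨u, hu, s, hs, he⟩
  -- This length forces `n + 1` terms into one translate; one of them is spent on the differences.
  obtain ⟨x, hx, hT⟩ := h (t.card * (n + 1))
  choose u hut s hs hus using fun k => ht' (x k) (hx k)
  have htne : t.Nonempty := by
    obtain ⟨y, hy⟩ := hne
    obtain ⟨w, hw, -⟩ := ht' y hy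
    exact ⟨w, hw⟩
  obtain ⟨w, -, hw⟩ := Finset.exists_le_card_fiber_of_mul_le_card_of_maps_to
    (s := Finset.univ) (f := u) (n := n + 1) (fun k _ => hut k) htne (by simp)
  let σ : Fin (n + 1) ↪o Fin (t.card * (n + 1)) := Finset.orderEmbOfCardLe _ hw
  have hσ : ∀ k, u (σ k) = w := fun k =>
    (Finset.mem_filter.1 (Finset.orderEmbOfCardLe_mem _ hw k)).2
  choose f hf hfx using hT
  -- The common translate and the `ε` terms cancel modulo `Y`. The factor `4⁻¹` comes from a
  -- half-difference of half-differences, which keeps `y k` in `C`. Since `0 < i.succ`, the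
  -- functional at `σ i.succ` kills `x (σ 0)`.
  let y : Fin n → X := fun k =>
    (4 : ℝ)⁻¹ • (x (σ k.succ) - x (σ 0) - ε • (s (σ k.succ) - s (σ 0)))
  have h0 : (0 : X) ∈ C := by
    obtain ⟨v, hv⟩ := hne
    have := hconvex hv (hsymm v hv) (by norm_num : (0 : ℝ) ≤ 1 / 2) (by norm_num : (0 : ℝ) ≤ 1 / 2)
      (by norm_num)
    simpa using this
  have hhalf : ∀ a ∈ C, ∀ b ∈ C, (2 : ℝ)⁻¹ • (a - b) ∈ C := fun a ha b hb => by
    have := hconvex ha (hsymm b hb) (by norm_num : (0 : ℝ) ≤ 2⁻¹) (by norm_num : (0 : ℝ) ≤ 2⁻¹)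
      (by norm_num)
    simpa [smul_sub, sub_eq_add_neg] using this
  refine ⟨y, fun k => ⟨?_, ?_⟩, ?_⟩
  · have h1 := hhalf _ (hhalf _ (hx (σ k.succ)) _ (hx (σ 0)))
      _ (hconvex.smul_mem_of_zero_mem h0 (hhalf _ (hs (σ k.succ)) _ (hs (σ 0))) ⟨hε.le, hε1⟩)
    convert h1 using 1
    simp only [y]
    module
  · rw [← Submodule.ker_mkQ Y, LinearMap.mem_ker]
    simp only [y, map_smul, map_sub, hus, hσ]
    module
  · have hθ8 : θ / 8 = θ / 4 / 2 := by ring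
    rw [hθ8]
    refine IsTriangular.of_approx hεn (by positivity) (f := fun i => f (σ i.succ))
      (fun i => hf _) fun i k => ?_
    have hfs : ∀ k, |f (σ i.succ) (s (σ k))| ≤ M := fun k =>
      (((f (σ i.succ)).le_opNorm _).trans (mul_le_of_le_one_left (norm_nonneg _) (hf _))).trans
        (hM _ (hs _))
    have hval : f (σ i.succ) (y k) - (if i ≤ k then θ / 4 else 0) =
        -(ε / 4 * (f (σ i.succ) (s (σ k.succ)) - f (σ i.succ) (s (σ 0)))) := by
      simp only [y, map_smul, map_sub, hfx, σ.le_iff_le, Fin.succ_le_succ_iff, smul_eq_mul]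
      rw [if_neg (by simp : ¬ i.succ ≤ 0)]
      split_ifs <;> ring
    rw [hval, abs_neg, abs_mul, abs_of_pos (by positivity : 0 < ε / 4)]
    have h1 := (abs_sub (f (σ i.succ) (s (σ k.succ))) (f (σ i.succ) (s (σ 0)))).trans
      (add_le_add (hfs _) (hfs _))
    calc _ ≤ ε / 4 * (M + M) := by gcongr
      _ ≤ ε * M := by nlinarith [mul_pos hε hM0]

end FiniteCodimension

/-! ### Infinite triangular sequences contradict weak compactness. -/

section WeakCompactness

variable {Z : Type*} [NormedAddCommGroup Z] [NormedSpace ℝ Z]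

/-- A relatively weakly compact set contains no infinite triangular sequence. -/
theorem IsRelWeaklyCompact.not_isTriangular {D : Set Z} (hD : IsRelWeaklyCompact D) {θ : ℝ}
    (hθ : 0 < θ) {z : ℕ → Z} (hz : ∀ k, z k ∈ D) : ¬ IsTriangular θ z := by
  intro hT
  obtain ⟨w', -, hw⟩ := IsCompact.exists_mapClusterPt (f := atTop)
    (u := fun k => toWeakSpace ℝ Z (z k)) hD
    (Filter.tendsto_principal.2 (Eventually.of_forall fun k => subset_closure ⟨_, hz k, rfl⟩))
  obtain ⟨w, rfl⟩ := (toWeakSpace ℝ Z).surjective w'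
  have hlim : ∀ (f : StrongDual ℝ Z) (c : ℝ), (∀ᶠ k in atTop, f (z k) = c) → f w = c := by
    intro f c hc
    have hcont : Continuous fun y : WeakSpace ℝ Z => f ((toWeakSpace ℝ Z).symm y) :=
      WeakBilin.eval_continuous (topDualPairing ℝ Z).flip f
    have hcl : MapClusterPt (f w) atTop fun k => f (z k) :=
      MapClusterPt.continuousAt_comp (X := WeakSpace ℝ Z) hcont.continuousAt hw
    by_contra hne
    obtain ⟨k, hk, hk'⟩ := ((hcl.frequently (isOpen_ne.mem_nhds hne)).and_eventually hc).exists
    exact hk hk'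
  choose f hf hfz using hT
  have hfw : ∀ i, f i w = θ := fun i => hlim (f i) θ <| by
    filter_upwards [eventually_ge_atTop i] with k hk
    rw [hfz, if_pos hk]
  -- Mazur's argument: a functional separating `w` from the span would vanish on the span, hence at
  -- `w`.
  have hspan : w ∈ closure (Submodule.span ℝ (Set.range z) : Set Z) := by
    by_contra hmem
    obtain ⟨g, u, hg, hu⟩ := geometric_hahn_banach_closed_point
      (Submodule.span ℝ (Set.range z)).convex.closure isClosed_closure hmem
    have hg' : ∀ v ∈ Submodule.span ℝ (Set.range z), g v < u := fun v hv => hg v (subset_closure hv)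
    have hu0 : 0 < u := by simpa using hg' 0 (zero_mem _)
    have hzero : ∀ k, g (z k) = 0 := fun k => by
      by_contra hne
      have := hg' ((u / g (z k)) • z k)
        (Submodule.smul_mem _ _ (Submodule.subset_span ⟨k, rfl⟩))
      rw [map_smul, smul_eq_mul, div_mul_cancel₀ _ hne] at this
      exact lt_irrefl _ this
    rw [hlim g 0 (Eventually.of_forall hzero)] at hu
    exact lt_asymm hu hu0
  obtain ⟨v, hv, hvw⟩ := Metric.mem_closure_iff.1 hspan θ hθ
  obtain ⟨a, rfl⟩ := Finsupp.mem_span_range_iff_exists_finsupp.1 hv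
  obtain ⟨i, hi⟩ := a.support.exists_nat_subset_range
  have hfv : f i (a.sum fun k c => c • z k) = 0 := by
    rw [Finsupp.sum, map_sum]
    refine Finset.sum_eq_zero fun k hk => ?_
    rw [map_smul, hfz, if_neg (Finset.mem_range.1 (hi hk)).not_ge, smul_zero]
  have h1 : θ = f i (w - a.sum fun k c => c • z k) := by rw [map_sub, hfw, hfv, sub_zero]
  have h2 := ((f i).le_opNorm (w - a.sum fun k c => c • z k)).trans
    (mul_le_of_le_one_left (norm_nonneg _) (hf i))
  rw [← h1, Real.norm_eq_abs, abs_of_pos hθ, ← dist_eq_norm] at h2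
  exact hvw.not_ge h2

end WeakCompactness

/-! ### Gluing finite systems in an ultrapower; the equivalence. -/

variable {X : Type u} [NormedAddCommGroup X] [NormedSpace ℝ X]

/-- Arbitrarily long finite triangular systems in `C` combine to an infinite one in an ultrapower
of `C`. -/
theorem exists_isTriangular_ultraSet {I : Type v} {𝓤 : Ultrafilter I} (len : I → ℕ)
    (hlen : Tendsto len 𝓤 atTop) {C : Set X} (hbounded : Bornology.IsBounded C) {θ : ℝ}
    (hC : C.Nonempty)
    (h : ∀ n : ℕ, ∃ x : Fin n → X, (∀ k, x k ∈ C) ∧ IsTriangular θ x) :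
    ∃ z : ℕ → Ultrapower X 𝓤, (∀ k, z k ∈ ultraSet 𝓤 C) ∧ IsTriangular θ z := by
  choose x hx hT using h
  obtain ⟨c, hc⟩ := hC
  obtain ⟨M, hM⟩ := hbounded.exists_norm_le
  -- The filler `c` is harmless: for fixed `k` it occurs only outside a set of `𝓤`, as `len` tends
  -- to infinity.
  let y : ℕ → I → X := fun k i => if hk : k < len i then x (len i) ⟨k, hk⟩ else c
  have hy : ∀ k i, y k i ∈ C := fun k i => by
    dsimp only [y]
    split_ifs
    · exact hx _ _
    · exact hc
  let Y : ℕ → lp (fun _ : I => X) ∞ := fun k =>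
    ⟨y k, memℓp_infty ⟨M, by rintro _ ⟨i, rfl⟩; exact hM _ (hy k i)⟩⟩
  refine ⟨fun k => (ultraNull X 𝓤).mkQ (Y k), fun k => ⟨Y k, hy k, rfl⟩, fun j => ?_⟩
  obtain ⟨f, hf, hfz⟩ := exists_dual_comp_eq
    (Finsupp.linearCombination ℝ fun k => (ultraNull X 𝓤).mkQ (Y k))
    (Finsupp.linearCombination ℝ fun k => if j ≤ k then θ else 0) fun a => by
      have hsum : Finsupp.linearCombination ℝ (fun k => (ultraNull X 𝓤).mkQ (Y k)) a =
          (ultraNull X 𝓤).mkQ (∑ k ∈ a.support, a k • Y k) := by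
        rw [Finsupp.linearCombination_apply, Finsupp.sum, map_sum]
        rfl
      rw [hsum]
      -- The functional `g` varies with `i`; only the norm inequality passes to the ultrapower.
      refine le_norm_mkQ_of_eventually_le ?_
      obtain ⟨m, hm⟩ := a.support.exists_nat_subset_range
      filter_upwards [hlen.eventually_gt_atTop (max m j)] with i hi
      obtain ⟨g, hg, hgx⟩ := hT (len i) ⟨j, (le_max_right _ _).trans_lt hi⟩
      have happ : (∑ k ∈ a.support, a k • Y k : lp (fun _ : I => X) ∞) i =
          ∑ k ∈ a.support, a k • y k i := by
        rw [lp.coeFn_sum, Finset.sum_apply]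
        rfl
      have hval : g (∑ k ∈ a.support, a k • y k i) =
          Finsupp.linearCombination ℝ (fun k => if j ≤ k then θ else 0) a := by
        rw [map_sum, Finsupp.linearCombination_apply, Finsupp.sum]
        refine Finset.sum_congr rfl fun k hk => ?_
        have hklt : k < len i :=
          (Finset.mem_range.1 (hm hk)).trans ((le_max_left _ _).trans_lt hi)
        have hyk : y k i = x (len i) ⟨k, hklt⟩ := dif_pos hklt
        rw [map_smul, hyk, hgx]
        simp [Fin.le_def]
      rw [happ, ← hval, ← Real.norm_eq_abs]
      exact (g.le_opNorm _).trans (mul_le_of_le_one_left (norm_nonneg _) hg)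
  refine ⟨f, hf, fun k => ?_⟩
  have := hfz (Finsupp.single k 1)
  simpa using this

theorem theorem3p10 {X : Type u} [NormedAddCommGroup X] [NormedSpace ℝ X] [CompleteSpace X]
    (C : Set X) (hclosed : IsClosed C) (hconvex : Convex ℝ C)
    (hbounded : Bornology.IsBounded C) (hsymm : ∀ x ∈ C, -x ∈ C) :
    ¬ IsSWC.{u, v} C ↔
      ∃ θ : ℝ, 0 < θ ∧
        ∀ Y : Submodule ℝ X, FiniteDimensional ℝ (X ⧸ Y) →
          ∀ n : ℕ, ∃ (x : Fin n → X) (f : Fin n → StrongDual ℝ X),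
            (∀ k, x k ∈ C ∧ x k ∈ Y) ∧ (∀ i, ‖f i‖ ≤ 1) ∧
            (∀ i k, k < i → f i (x k) = 0) ∧ (∀ i k, i ≤ k → f i (x k) = θ) := by
  constructor
  · intro hC
    -- A closed convex set is weakly closed, so it is the ultrapower condition that fails.
    have hweak : IsClosed (toWeakSpace ℝ X '' C) := by
      rw [← hclosed.closure_eq, hconvex.toWeakSpace_closure ℝ]
      exact isClosed_closure
    obtain ⟨I, 𝓤, -, hnot⟩ : ∃ (I : Type v) (𝓤 : Ultrafilter I), (∀ i : I, 𝓤 ≠ pure i) ∧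
        ¬ IsRelWeaklyCompact (ultraSet 𝓤 C) := by
      by_contra! hcon
      exact hC ⟨hweak, hcon⟩
    obtain ⟨θ, hθ, hT⟩ :=
      exists_isTriangular_of_not_isRelWeaklyCompact (isBounded_ultraSet hbounded) hnot
    -- The factor 2 is lost in descending to a coordinate, the factor 8 in entering `Y`.
    refine ⟨θ / 2 / 8, by positivity, fun Y _ n => ?_⟩
    obtain ⟨x, hx, hxT⟩ := exists_isTriangular_mem_of_finiteDimensional_quotient hconvex hbounded
      hsymm (half_pos hθ) (fun m => by
        obtain ⟨z, hz, hzT⟩ := hT m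
        choose y hy hyz using hz
        obtain ⟨i, hi⟩ := exists_isTriangular_of_mkQ (𝓤 := 𝓤) (x := y) hθ (by simpa only [hyz])
        exact ⟨fun k => y k i, fun k => hy k i, hi⟩) Y n
    choose f hf hfx using hxT
    exact ⟨x, f, hx, hf, fun i k hik => by rw [hfx, if_neg hik.not_ge],
      fun i k hik => by rw [hfx, if_pos hik]⟩
  · rintro ⟨θ, hθ, h⟩ hC
    have hT : ∀ n : ℕ, ∃ x : Fin n → X, (∀ k, x k ∈ C) ∧ IsTriangular θ x := fun n => by
      obtain ⟨x, f, hx, hf, hlt, hle⟩ := h ⊤ inferInstance n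
      refine ⟨x, fun k => (hx k).1, fun i => ⟨f i, hf i, fun k => ?_⟩⟩
      split_ifs with hik
      · exact hle i k hik
      · exact hlt i k (not_le.1 hik)
    have hne : C.Nonempty := by
      obtain ⟨x, hx, -⟩ := hT 1
      exact ⟨x 0, hx 0⟩
    let 𝓤 : Ultrafilter (ULift.{v} ℕ) := (hyperfilter ℕ).map ULift.up
    have hlen : Tendsto ULift.down (𝓤 : Filter (ULift.{v} ℕ)) atTop := by
      rw [Ultrafilter.coe_map, tendsto_map'_iff]
      exact tendsto_id.mono_left Nat.hyperfilter_le_atTop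
    have hfree : ∀ i, 𝓤 ≠ pure i := fun i hi => by
      rw [hi, Ultrafilter.coe_pure] at hlen
      exact lt_irrefl _ (eventually_pure.1 (hlen.eventually_gt_atTop i.down))
    obtain ⟨z, hz, hzT⟩ := exists_isTriangular_ultraSet (𝓤 := 𝓤) ULift.down hlen hbounded hne
      hT
    exact (hC.2 _ 𝓤 hfree).not_isTriangular hθ hz hzT
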